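/- Let $S,\Lambda\in\mathbb{R}^{p\times p}$ be symmetric matrices ($S$ the sample covariance matrix) with $\Lambda_{ij}\ge 0$ for $i\ne j$, and consider the graphical lasso $$\min_{\Theta\succ 0}\; -\log\det\Theta+\langle\Theta,S\rangle+\sum_{i\neq j}\Lambda_{ij}|\Theta_{ij}| .\qquad(1)$$ Let $T$ be the thresholded matrix, $T_{ij}=0$ if $|S_{ij}|\le\Lambda_{ij}$ and $T_{ij}=S_{ij}-\Lambda_{ij}\,\mathrm{sign}(S_{ij})$ if $|S_{ij}|>\Lambda_{ij}$. Let $G$ be its support graph (distinct $i,j$ are adjacent iff $T_{ij}\ne0$), let $\mathcal B$ be the set of bridges of $G$ (edges whose deletion increases the number of components), and let $\mathcal V_1,\dots,\mathcal V_K$ be the bridge-block decomposition of $G$, i.e. the connected components of $G$ with all edges of $\mathcal B$ removed. Assume that $T_{ij}^2\neq S_{ii}S_{jj}$ for all $(i,j)\in\mathcal B$. For each $k$ let $\widehat\Theta_k$ be an optimal solution of the sub-problem obtained from (1) by replacing $S,\Lambda$ with their principal submatrices on $\mathcal V_k$; index its rows and columns by $\mathcal V_k$. Define $$\Theta_{ij}=\begin{cases}[\widehat\Theta_k]_{ii}+\zeta_i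 & i=j\in\mathcal V_k,\\ [\widehat\Theta_k]_{ij} & i\ne j,\ i,j\in\mathcal V_k,\\ -T_{ij}/(S_{ii}S_{jj}-T_{ij}^2) & (i,j)\in\mathcal B,\\ 0&\text{otherwise,}\end{cases}\qquad \zeta_i=\frac1{S_{ii}}\sum_{m:(i,m)\in\mathcal B}\frac{T_{im}^2}{S_{ii}S_{mm}-T_{im}^2},$$ and $$R_{ij}=\begin{cases}[\widehat\Theta_k^{-1}]_{ij} & i,j\in\mathcal V_k,\\ T_{ij} & (i,j)\in\mathcal B,\\ \sqrt{S_{ii}S_{jj}}\;g_{ij}&\text{otherwise,}\end{cases}$$ where $g_{ij}=0$ if $G$ has no path from $i$ to $j$, and otherwise, if $(u_1,u_2),\dots,(u_{2N-1},u_{2N})$ are the bridges on a path from $i$ to $j$ in the order and direction in which it traverses them, and $u_0=i$, $u_{2N+1}=j$, $$g_{ij}=\prod_{t=0}^{2N}\frac{R_{u_t,u_{t+1}}}{\sqrt{S_{u_tu_t}S_{u_{t+1}u_{t+1}}}} .$$ Then $R=\Theta^{-1}$. If moreover $\Theta\succ0$ and $|S_{ij}-R_{ij}|\le\Lambda_{ij}$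 for all $i,j$ belonging to different clusters, then $\Theta$ is an optimal solution of (1). -/

import Mathlib

namespace GLasso

/-! ### The graphical lasso -/

section Problem

variable {ι : Type*} [Fintype ι] [DecidableEq ι]

/-- The graphical lasso objective
`-log det Θ + ⟨Θ, S⟩ + ∑_{i ≠ j} Λ_ij |Θ_ij|` (the diagonal of `Λ` plays no role). -/
noncomputable def objective (S Λ Θ : Matrix ι ι ℝ) : ℝ :=
  -Real.log Θ.det + ∑ i, ∑ j, Θ i j * S i j
    + ∑ i, ∑ j, if i ≠ j then Λ i j * |Θ i j| else 0

/-- `Θ` minimizes the graphical lasso objective over all (symmetric) positive definite matrices. -/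
def IsOptimal (S Λ Θ : Matrix ι ι ℝ) : Prop :=
  Θ.PosDef ∧ ∀ Θ' : Matrix ι ι ℝ, Θ'.PosDef → objective S Λ Θ ≤ objective S Λ Θ'

end Problem

/-! ### The thresholded matrix, its graph, bridges and the bridge-block decomposition -/

section Graph

variable {V : Type*}

open Classical in
/-- Sign-aware soft thresholding of `S` at level `Λ`. -/
noncomputable def thresholded (S Λ : Matrix V V ℝ) : Matrix V V ℝ :=
  fun i j => if |S i j| ≤ Λ i j then 0 else S i j - Λ i j * Real.sign (S i j)

/-- The support graph of a symmetric matrix: distinct `i`, `j` are adjacent iff `A i j ≠ 0`. -/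
def supportGraph (A : Matrix V V ℝ) : SimpleGraph V :=
  SimpleGraph.fromRel fun i j => A i j ≠ 0

/-- `(i, j)` is an edge of `G` whose deletion disconnects its end points.
(`SimpleGraph.IsBridge` alone does not ask for `(i, j)` to be an edge.) -/
def BridgeEdge (G : SimpleGraph V) (i j : V) : Prop :=
  G.Adj i j ∧ G.IsBridge s(i, j)

/-- The graph `G` with all its bridges removed. -/
def blockGraph (G : SimpleGraph V) : SimpleGraph V :=
  G.deleteEdges {e | e ∈ G.edgeSet ∧ G.IsBridge e}

/-- The index set of the bridge-block decomposition:
the connected components of `G` with all its bridges removed. -/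
abbrev Block (G : SimpleGraph V) : Type _ := (blockGraph G).ConnectedComponent

/-- The index of the cluster that contains a vertex. -/
abbrev blockOf (G : SimpleGraph V) (i : V) : Block G := (blockGraph G).connectedComponentMk i

/-- The `k`-th cluster of the bridge-block decomposition, as a type. -/
abbrev Cluster (G : SimpleGraph V) (k : Block G) : Type _ := {i : V // blockOf G i = k}

/-- A matrix for each cluster. -/
abbrev ClusterMatrices (G : SimpleGraph V) : Type _ :=
  (k : Block G) → Matrix (Cluster G k) (Cluster G k) ℝ

/-- The principal submatrix on the `k`-th cluster. -/
def clusterSubmatrix (G : SimpleGraph V) (A : Matrix V V ℝ) (k : Block G) :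
    Matrix (Cluster G k) (Cluster G k) ℝ :=
  A.submatrix Subtype.val Subtype.val

open Classical in
/-- The bridges on a path of `G` from `i` to `j`, in the order and the direction in which the path
traverses them; the empty list if there is no path. The list is the same for all
paths from `i` to `j`. -/
noncomputable def bridgePath (G : SimpleGraph V) (i j : V) : List (V × V) :=
  if h : ∃ p : G.Walk i j, p.IsPath then
    (h.choose.darts.map fun d => d.toProd).filter fun e => BridgeEdge G e.1 e.2
  else []

end Graph

section Forms

variable {V : Type*} [Fintype V] [DecidableEq V]

open Classical in
/-- `Θ̂ k` solves the graphical lasso restricted to the `k`-th cluster. -/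
def IsClusterOptimal (G : SimpleGraph V) (S Λ : Matrix V V ℝ) (k : Block G)
    (Θk : Matrix (Cluster G k) (Cluster G k) ℝ) : Prop :=
  IsOptimal (clusterSubmatrix G S k) (clusterSubmatrix G Λ k) Θk

open Classical in
/-- The family of the inverses of the cluster matrices. -/
noncomputable def clusterInverse (G : SimpleGraph V) (Θhat : ClusterMatrices G) :
    ClusterMatrices G :=
  fun k => (Θhat k)⁻¹

open Classical in
/-- `ζ i = S_ii⁻¹ ∑_{(i, m) bridge} T_im² / (S_ii S_mm - T_im²)`. -/
noncomputable def zeta (G : SimpleGraph V) (S T : Matrix V V ℝ) (i : V) : ℝ :=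
  1 / S i i * ∑ m, if BridgeEdge G i m then T i m ^ 2 / (S i i * S m m - T i m ^ 2) else 0

open Classical in
/-- The decomposed form assembled from matrices on the clusters of `G`
and explicit entries at the bridges of `G`. -/
noncomputable def decomposedForm (G : SimpleGraph V) (S T : Matrix V V ℝ)
    (Θhat : ClusterMatrices G) : Matrix V V ℝ :=
  fun i j =>
    if h : blockOf G i = blockOf G j then
      Θhat (blockOf G j) ⟨i, h⟩ ⟨j, rfl⟩ + if i = j then zeta G S T i else 0
    else if BridgeEdge G i j then -T i j / (S i i * S j j - T i j ^ 2)
    else 0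

open Classical in
/-- The factors of the path product: an entry of the inverse of a cluster matrix inside a cluster,
an entry of `T` otherwise (used only at bridges). -/
noncomputable def localEntry (G : SimpleGraph V) (T : Matrix V V ℝ) (Θhat : ClusterMatrices G)
    (i j : V) : ℝ :=
  if h : blockOf G i = blockOf G j then clusterInverse G Θhat (blockOf G j) ⟨i, h⟩ ⟨j, rfl⟩
  else T i j

/-- The vertices `u₀ = i, u₁, …, u_{2T}, u_{2T+1} = j` for a list
`(u₁, u₂), …, (u_{2T-1}, u_{2T})` of bridges. -/
def bridgeVertices (i j : V) (l : List (V × V)) : List V :=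
  i :: (l.flatMap fun e => [e.1, e.2]) ++ [j]

/-- The generalized path product `g_ij = ∏ R_{u_t, u_{t+1}} / √(S_{u_t,u_t} S_{u_{t+1},u_{t+1}})`
along the bridge path from `i` to `j`; zero if the bridge path is empty. -/
noncomputable def pathProduct (G : SimpleGraph V) (S T : Matrix V V ℝ) (Θhat : ClusterMatrices G)
    (i j : V) : ℝ :=
  if bridgePath G i j = [] then 0
  else
    (List.zipWith (fun a b => localEntry G T Θhat a b / √(S a a * S b b))
      (bridgeVertices i j (bridgePath G i j)) (bridgeVertices i j (bridgePath G i j)).tail).prod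

open Classical in
/-- The matrix `R`: the inverses of the cluster matrices inside the clusters, the entries of `T` at
the bridges, and `√(S_ii S_jj) g_ij` elsewhere. -/
noncomputable def inverseForm (G : SimpleGraph V) (S T : Matrix V V ℝ) (Θhat : ClusterMatrices G) :
    Matrix V V ℝ :=
  fun i j =>
    if h : blockOf G i = blockOf G j then clusterInverse G Θhat (blockOf G j) ⟨i, h⟩ ⟨j, rfl⟩
    else if BridgeEdge G i j then T i j
    else √(S i i * S j j) * pathProduct G S T Θhat i j

end Forms

end GLasso

/-! For `Θ * R = 1`, fix a column `j`. Since `ζ_i` is a sum over the bridges at `i`, each bridge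
`(i, m)` contributes its own term to entry `(i, j)`. If it leads away from `j`, then `R_mj = (T_mi /
S_ii) R_ij` and the term vanishes. If `j` is connected to `i` but lies in another block, exactly one
bridge `(u, v)` leads from the block of `i` towards `j`; on this block, column `j` of `R` is a
multiple of column `u` of the cluster inverse, so the cluster product lives at `u` only, where the
term of `(u, v)` cancels it. This uses `R_ii = S_ii`, which holds because the sub-problems do not
penalize the diagonal. See `decomposedForm_mul_inverseForm`.

Optimality is convexity: since `log det` is concave, it suffices that the first-order gaps
`entryGap` have nonnegative sum. Inside clusters they are the gaps of the optimal sub-solutions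
(`sum_entryGap_cluster_nonneg`); at bridges, soft thresholding makes `T - S` a subgradient of the
penalty (`sub_thresholded_mul_add_abs_nonneg`); elsewhere `Θ_ij = 0` and the bound on `|S_ij -
R_ij|` suffices. -/

namespace GLasso

/-! ### First-order optimality conditions -/

section Optimality

open Matrix Filter Topology
open scoped MatrixOrder Matrix.Norms.L2Operator

variable {ι : Type*} [Fintype ι]

/-- Small symmetric perturbations of a positive definite matrix are positive definite. -/
theorem eventually_posDef_add_smul {A H : Matrix ι ι ℝ} (hA : A.PosDef) (hH : H.IsHermitian) :
    ∀ᶠ t : ℝ in 𝓝 0, (A + t • H).PosDef := by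
  have hcont : Continuous fun z : ℝ × (ι → ℝ) => z.2 ⬝ᵥ ((A + z.1 • H) *ᵥ z.2) := by
    fun_prop
  -- Compactness of the sphere gives one neighbourhood of `t = 0` for all directions; other vectors
  -- follow by scaling.
  have hsphere : ∀ᶠ t : ℝ in 𝓝 0, ∀ x ∈ Metric.sphere (0 : ι → ℝ) 1,
      0 < x ⬝ᵥ ((A + t • H) *ᵥ x) := by
    refine (isCompact_sphere _ _).eventually_forall_of_forall_eventually fun x hx => ?_
    have hx0 : x ≠ 0 := by
      rintro rfl
      simp at hx
    refine hcont.continuousAt.eventually (lt_mem_nhds ?_)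
    simpa using hA.dotProduct_mulVec_pos hx0
  filter_upwards [hsphere] with t ht
  refine PosDef.of_dotProduct_mulVec_pos (hA.1.add (hH.smul (IsSelfAdjoint.all t))) fun x hx => ?_
  have hn : 0 < ‖x‖ := norm_pos_iff.2 hx
  have := ht (‖x‖⁻¹ • x) (by simp [norm_smul, hn.ne'])
  rw [mulVec_smul, smul_dotProduct, dotProduct_smul, smul_smul, smul_eq_mul] at this
  rw [star_trivial]
  exact pos_of_mul_pos_right this (by positivity)

theorem trace_mul_eq_sum_of_isHermitian (A : Matrix ι ι ℝ) {H : Matrix ι ι ℝ}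
    (hH : H.IsHermitian) : (A * H).trace = ∑ i, ∑ j, H i j * A i j := by
  simp only [trace, diag_apply, mul_apply]
  refine Finset.sum_congr rfl fun i _ => Finset.sum_congr rfl fun j _ => ?_
  rw [← hH.apply i j, star_trivial, mul_comm]

variable [DecidableEq ι]

/-- The log-determinant lies below its tangent at a positive definite matrix. -/
theorem log_det_le_tangent {A B : Matrix ι ι ℝ} (hA : A.PosDef) (hB : B.PosDef) :
    Real.log B.det ≤ Real.log A.det + (A⁻¹ * (B - A)).trace := by
  -- With `A⁻¹ = Cᴴ * C`, the claim becomes `log λ ≤ λ - 1` summed over the eigenvalues of `C * B *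
  -- Cᴴ`.
  obtain ⟨C, hC⟩ := CStarAlgebra.nonneg_iff_eq_star_mul_self.mp hA.inv.posSemidef.nonneg
  rw [star_eq_conjTranspose] at hC
  have hA0 : A.det ≠ 0 := hA.det_pos.ne'
  have hCdet : C.det * C.det = A.det⁻¹ := by
    have := congrArg Matrix.det hC
    rw [det_mul, det_conjTranspose, det_nonsing_inv, Ring.inverse_eq_inv'] at this
    simpa using this.symm
  have hC0 : C.det ≠ 0 := by
    intro h
    rw [h, zero_mul] at hCdet
    exact inv_ne_zero hA0 hCdet.symm
  have hCu : IsUnit C := (isUnit_iff_isUnit_det C).2 hC0.isUnit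
  have hM : (C * B * Cᴴ).PosDef :=
    hB.mul_mul_conjTranspose_same (vecMul_injective_of_isUnit hCu)
  have hdet : (C * B * Cᴴ).det = B.det / A.det := by
    rw [det_mul, det_mul, det_conjTranspose, star_trivial, mul_right_comm, hCdet]
    field_simp
  have htr : (C * B * Cᴴ).trace = (A⁻¹ * B).trace := by
    rw [trace_mul_comm, ← Matrix.mul_assoc, hC]
  have hone : (A⁻¹ * A).trace = Fintype.card ι := by
    rw [nonsing_inv_mul _ hA0.isUnit, trace_one]
  have hlog : Real.log (C * B * Cᴴ).det ≤ (C * B * Cᴴ).trace - Fintype.card ι := by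
    rw [hM.1.det_eq_prod_eigenvalues, hM.1.trace_eq_sum_eigenvalues]
    simp only [RCLike.ofReal_real_eq_id, id]
    rw [Real.log_prod fun i _ => (hM.eigenvalues_pos i).ne']
    calc ∑ i, Real.log (hM.1.eigenvalues i) ≤ ∑ i, (hM.1.eigenvalues i - 1) :=
          Finset.sum_le_sum fun i _ => Real.log_le_sub_one_of_pos (hM.eigenvalues_pos i)
      _ = _ := by simp
  rw [hdet, htr, Real.log_div hB.det_pos.ne' hA0] at hlog
  rw [Matrix.mul_sub, trace_sub, hone]
  linarith

/-- The first-order gap between `X` and `Θ` at the entry `(i, j)`, if `R` is the inverse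
of `Θ`. -/
noncomputable def entryGap (S Λ Θ R X : Matrix ι ι ℝ) (i j : ι) : ℝ :=
  (X i j - Θ i j) * (S i j - R i j) + if i ≠ j then Λ i j * (|X i j| - |Θ i j|) else 0

/-- The total gap is the change of the objective once `-log det` is replaced by its linearization at
`Θ`. -/
theorem sum_entryGap (S Λ Θ X : Matrix ι ι ℝ) (hΘ : Θ.IsHermitian) (hX : X.IsHermitian) :
    ∑ i, ∑ j, entryGap S Λ Θ Θ⁻¹ X i j =
      objective S Λ X - objective S Λ Θ + Real.log X.det - Real.log Θ.det
        - (Θ⁻¹ * (X - Θ)).trace := by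
  rw [trace_mul_eq_sum_of_isHermitian _ (hX.sub hΘ)]
  have h : ∀ i j, entryGap S Λ Θ Θ⁻¹ X i j = X i j * S i j - Θ i j * S i j
      - (X - Θ) i j * Θ⁻¹ i j + ((if i ≠ j then Λ i j * |X i j| else 0)
        - if i ≠ j then Λ i j * |Θ i j| else 0) := by
    intro i j
    rw [entryGap, Matrix.sub_apply]
    split_ifs <;> ring
  simp only [h, Finset.sum_add_distrib, Finset.sum_sub_distrib, objective]
  ring

theorem isOptimal_of_sum_entryGap_nonneg {S Λ Θ : Matrix ι ι ℝ} (hΘ : Θ.PosDef)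
    (h : ∀ X : Matrix ι ι ℝ, X.PosDef → 0 ≤ ∑ i, ∑ j, entryGap S Λ Θ Θ⁻¹ X i j) :
    IsOptimal S Λ Θ := by
  refine ⟨hΘ, fun X hX => ?_⟩
  have h1 := h X hX
  rw [sum_entryGap _ _ _ _ hΘ.1 hX.1] at h1
  have h2 := log_det_le_tangent hΘ hX
  linarith

/-- Adding `log det` back leaves a linear term plus the penalty, which is convex because its weights
are nonnegative. As the logarithm cancels, `X` need not be positive definite. -/
theorem objective_add_smul_le {S Λ : Matrix ι ι ℝ} (hΛ : ∀ i j, i ≠ j → 0 ≤ Λ i j)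
    (Θ X : Matrix ι ι ℝ) {t : ℝ} (ht0 : 0 ≤ t) (ht1 : t ≤ 1) :
    objective S Λ (Θ + t • (X - Θ)) + Real.log (Θ + t • (X - Θ)).det ≤
      objective S Λ Θ + Real.log Θ.det + t * (objective S Λ X + Real.log X.det
        - (objective S Λ Θ + Real.log Θ.det)) := by
  have hlin : ∑ i, ∑ j, (Θ + t • (X - Θ)) i j * S i j =
      (1 - t) * ∑ i, ∑ j, Θ i j * S i j + t * ∑ i, ∑ j, X i j * S i j := by
    simp only [Finset.mul_sum, ← Finset.sum_add_distrib]
    refine Finset.sum_congr rfl fun i _ => Finset.sum_congr rfl fun j _ => ?_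
    simp only [Matrix.add_apply, Matrix.smul_apply, Matrix.sub_apply, smul_eq_mul]
    ring
  have hpen : (∑ i, ∑ j, if i ≠ j then Λ i j * |(Θ + t • (X - Θ)) i j| else 0) ≤
      (1 - t) * (∑ i, ∑ j, if i ≠ j then Λ i j * |Θ i j| else 0)
        + t * ∑ i, ∑ j, if i ≠ j then Λ i j * |X i j| else 0 := by
    simp only [Finset.mul_sum, ← Finset.sum_add_distrib]
    refine Finset.sum_le_sum fun i _ => Finset.sum_le_sum fun j _ => ?_
    split_ifs with hij
    · have habs : |(Θ + t • (X - Θ)) i j| ≤ (1 - t) * |Θ i j| + t * |X i j| := by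
        have : (Θ + t • (X - Θ)) i j = (1 - t) * Θ i j + t * X i j := by
          simp only [Matrix.add_apply, Matrix.smul_apply, Matrix.sub_apply, smul_eq_mul]
          ring
        rw [this]
        refine (abs_add_le _ _).trans_eq ?_
        rw [abs_mul, abs_mul, abs_of_nonneg ht0, abs_of_nonneg (sub_nonneg.2 ht1)]
      calc Λ i j * |(Θ + t • (X - Θ)) i j|
          ≤ Λ i j * ((1 - t) * |Θ i j| + t * |X i j|) :=
            mul_le_mul_of_nonneg_left habs (hΛ i j hij)
        _ = _ := by ring
    · simp
  simp only [objective, hlin]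
  linarith

/-- The first-order optimality condition of the graphical lasso, as a variational inequality. -/
theorem IsOptimal.sum_entryGap_nonneg {S Λ Θ : Matrix ι ι ℝ} (hΛ : ∀ i j, i ≠ j → 0 ≤ Λ i j)
    (hΘ : IsOptimal S Λ Θ) {X : Matrix ι ι ℝ} (hX : X.IsHermitian) :
    0 ≤ ∑ i, ∑ j, entryGap S Λ Θ Θ⁻¹ X i j := by
  rw [sum_entryGap _ _ _ _ hΘ.1.1 hX]
  set H := X - Θ with hHdef
  have hH : H.IsHermitian := hX.sub hΘ.1.1
  have hpd : ∀ᶠ t : ℝ in 𝓝[>] 0, (Θ + t • H).PosDef :=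
    (eventually_posDef_add_smul hΘ.1 hH).filter_mono nhdsWithin_le_nhds
  have hle : ∀ᶠ t : ℝ in 𝓝[>] 0, t ≤ 1 :=
    (eventually_le_nhds zero_lt_one).filter_mono nhdsWithin_le_nhds
  have hcont : ContinuousAt (fun t : ℝ => ((Θ + t • H)⁻¹ * H).trace) 0 := by
    have hc : Continuous fun t : ℝ => Θ + t • H := by fun_prop
    have hinv : ContinuousAt (fun t : ℝ => (Θ + t • H)⁻¹) 0 := by
      have hd : (Θ + (0 : ℝ) • H).det ≠ 0 := by simpa using hΘ.1.det_pos.ne'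
      simp only [inv_def, Ring.inverse_eq_inv']
      exact (hc.matrix_det.continuousAt.inv₀ hd).smul hc.matrix_adjugate.continuousAt
    have htr : Continuous fun M : Matrix ι ι ℝ => (M * H).trace := by fun_prop
    exact htr.continuousAt.comp hinv
  have hlim : Tendsto (fun t : ℝ => ((Θ + t • H)⁻¹ * H).trace) (𝓝[>] 0)
      (𝓝 ((Θ⁻¹ * H).trace)) := by
    have := hcont.tendsto
    rw [zero_smul, add_zero] at this
    exact this.mono_left nhdsWithin_le_nhds
  have hbound : ∀ᶠ t : ℝ in 𝓝[>] 0, ((Θ + t • H)⁻¹ * H).trace ≤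
      objective S Λ X + Real.log X.det - (objective S Λ Θ + Real.log Θ.det) := by
    filter_upwards [hpd, hle, self_mem_nhdsWithin] with t htpd ht1 ht0
    rw [Set.mem_Ioi] at ht0
    have h1 := hΘ.2 _ htpd
    have h2 := objective_add_smul_le (S := S) hΛ Θ X ht0.le ht1
    -- The tangent is based at the moving point and evaluated at `Θ`. Dividing by `t` and letting
    -- `t` tend to `0` from above then needs only continuity of the inverse, not a derivative of
    -- `log det`.
    have h3 := log_det_le_tangent htpd hΘ.1
    have h4 : Θ - (Θ + t • H) = -(t • H) := by abel
    rw [h4, Matrix.mul_neg, Matrix.mul_smul, trace_neg, trace_smul, smul_eq_mul] at h3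
    rw [← hHdef] at h2
    refine le_of_mul_le_mul_left ?_ ht0
    linarith
  have := le_of_tendsto hlim hbound
  linarith

/-- The inverse of an optimal solution agrees with `S` on the diagonal. -/
theorem IsOptimal.inv_diag {S Λ Θ : Matrix ι ι ℝ} (hΛ : ∀ i j, i ≠ j → 0 ≤ Λ i j)
    (hΘ : IsOptimal S Λ Θ) (a : ι) : Θ⁻¹ a a = S a a := by
  -- Diagonal perturbations are free of penalty and may have either sign.
  have key : ∀ c : ℝ, 0 ≤ c * (S a a - Θ⁻¹ a a) := by
    intro c
    have hdiag : (diagonal (Pi.single a c) : Matrix ι ι ℝ).IsHermitian :=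
      isHermitian_diagonal _
    have h := hΘ.sum_entryGap_nonneg hΛ (hΘ.1.1.add hdiag)
    have hg : ∀ i j, entryGap S Λ Θ Θ⁻¹ (Θ + diagonal (Pi.single a c)) i j =
        if i = j then (Pi.single a c : ι → ℝ) i * (S i i - Θ⁻¹ i i) else 0 := by
      intro i j
      by_cases hij : i = j
      · subst hij
        simp [entryGap]
      · simp [entryGap, hij]
    simp only [hg, Finset.sum_ite_eq, Finset.mem_univ, if_true] at h
    rwa [Finset.sum_eq_single a (fun b _ hb => by simp [Pi.single_eq_of_ne hb]) (by simp),
      Pi.single_eq_same] at h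
  have h1 := key 1
  have h2 := key (-1)
  linarith

end Optimality

/-! ### Bridges and the uniqueness of bridge lists -/

section Bridges

variable {V : Type*} {G : SimpleGraph V} {i j u v m : V} {l l' : List (V × V)}

theorem BridgeEdge.symm (h : BridgeEdge G u v) : BridgeEdge G v u :=
  ⟨h.1.symm, Sym2.eq_swap (a := u) (b := v) ▸ h.2⟩

theorem blockGraph_le_deleteEdges (h : BridgeEdge G u v) :
    blockGraph G ≤ G.deleteEdges {s(u, v)} := by
  refine SimpleGraph.deleteEdges_anti fun e he => ?_
  rw [Set.mem_singleton_iff] at he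
  subst he
  exact ⟨h.1, h.2⟩

theorem BridgeEdge.reachable_deleteEdges (h : BridgeEdge G u v)
    (hij : blockOf G i = blockOf G j) : (G.deleteEdges {s(u, v)}).Reachable i j :=
  (SimpleGraph.ConnectedComponent.exact hij).mono (blockGraph_le_deleteEdges h)

theorem BridgeEdge.not_reachable (h : BridgeEdge G u v) :
    ¬ (G.deleteEdges {s(u, v)}).Reachable u v :=
  SimpleGraph.isBridge_iff.1 h.2

theorem BridgeEdge.blockOf_ne (h : BridgeEdge G u v) : blockOf G u ≠ blockOf G v :=
  fun huv => h.not_reachable (h.reachable_deleteEdges huv)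

theorem blockOf_eq_of_adj (h : G.Adj u v) (hb : ¬ BridgeEdge G u v) :
    blockOf G u = blockOf G v := by
  refine SimpleGraph.ConnectedComponent.sound (SimpleGraph.Adj.reachable ?_)
  exact SimpleGraph.deleteEdges_adj.2 ⟨h, fun he => hb ⟨h, he.2⟩⟩

theorem reachable_of_blockOf_eq (h : blockOf G i = blockOf G j) : G.Reachable i j :=
  (SimpleGraph.ConnectedComponent.exact h).mono (SimpleGraph.deleteEdges_le _)

/-- A walk avoiding one edge either avoids a second edge as well or shows that its start
is connected to both ends of the second edge. -/
theorem reachable_deleteEdges_or {e : Sym2 V} (h : (G.deleteEdges {e}).Reachable i j) :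
    (G.deleteEdges {s(u, v)}).Reachable i j ∨ (G.deleteEdges {e}).Reachable i u := by
  classical
  obtain ⟨p⟩ := h
  by_cases hp : s(u, v) ∈ p.edges
  · exact .inr ⟨p.takeUntil u (p.fst_mem_support_of_mem_edges hp)⟩
  · refine .inl ?_
    rw [SimpleGraph.reachable_deleteEdges_iff_exists_walk]
    exact ⟨p.mapLe (SimpleGraph.deleteEdges_le _), by simpa using hp⟩

/-- If the bridge `(u, v)` leads from the block of `i` towards `j`, then any other bridge
leaving this block leads away from `j`. -/
theorem BridgeEdge.reachable_of_ne (huv : BridgeEdge G u v) (hiu : blockOf G i = blockOf G u)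
    (hvj : (G.deleteEdges {s(u, v)}).Reachable v j) (him : BridgeEdge G i m)
    (hne : (i, m) ≠ (u, v)) : (G.deleteEdges {s(i, m)}).Reachable i j := by
  have hi : (G.deleteEdges {s(i, m)}).Reachable i u := him.reachable_deleteEdges hiu
  have hedge : s(u, v) ≠ s(i, m) := by
    intro h
    rcases Sym2.eq_iff.1 h with ⟨rfl, rfl⟩ | ⟨rfl, rfl⟩
    · exact hne rfl
    · exact huv.blockOf_ne hiu.symm
  have hadj : (G.deleteEdges {s(i, m)}).Adj u v :=
    SimpleGraph.deleteEdges_adj.2 ⟨huv.1, by simpa using hedge⟩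
  -- Either the walk from `v` to `j` avoids `(i, m)`, and can be preceded by `i, …, u, v`, or it
  -- visits `i`, which joins `v` to `u` without the bridge `(u, v)`.
  rcases reachable_deleteEdges_or (u := i) (v := m) hvj with h | h
  · exact hi.trans (hadj.reachable.trans h)
  · exact absurd (h.trans (huv.reachable_deleteEdges hiu)).symm huv.not_reachable

/-- `l` lists the bridges that separate `i` from `j`, in order and directed towards `j`. -/
inductive IsBridgeList (G : SimpleGraph V) : V → V → List (V × V) → Prop
  | nil {i j : V} : blockOf G i = blockOf G j → IsBridgeList G i j []
  | cons {i j u v : V} {l : List (V × V)} : blockOf G i = blockOf G u → BridgeEdge G u v →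
      (G.deleteEdges {s(u, v)}).Reachable v j → IsBridgeList G v j l →
      IsBridgeList G i j ((u, v) :: l)

theorem IsBridgeList.congr_left (him : blockOf G i = blockOf G m) (h : IsBridgeList G m j l) :
    IsBridgeList G i j l := by
  cases h with
  | nil h => exact .nil (him.trans h)
  | cons h1 h2 h3 h4 => exact .cons (him.trans h1) h2 h3 h4

theorem not_blockOf_eq_of_reachable (huv : BridgeEdge G u v) (hiu : blockOf G i = blockOf G u)
    (hvj : (G.deleteEdges {s(u, v)}).Reachable v j) : blockOf G i ≠ blockOf G j := fun hij =>
  huv.not_reachable ((huv.reachable_deleteEdges (hiu.symm.trans hij)).trans hvj.symm)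

/-- If the first bridges differed, the second would lead away from `j` as well as towards it. Hence
the path chosen in `bridgePath` is immaterial. -/
theorem IsBridgeList.unique (h : IsBridgeList G i j l) (h' : IsBridgeList G i j l') :
    l = l' := by
  induction h generalizing l' with
  | nil hij =>
    cases h' with
    | nil _ => rfl
    | cons h1 h2 h3 _ => exact absurd hij (not_blockOf_eq_of_reachable h2 h1 h3)
  | @cons i j u v l h1 h2 h3 h4 ih =>
    cases h' with
    | nil hij => exact absurd hij (not_blockOf_eq_of_reachable h2 h1 h3)
    | @cons _ _ u' v' l' h1' h2' h3' h4' =>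
      have huv : (u', v') = (u, v) := by
        by_contra hne
        have := h2.reachable_of_ne (h1'.symm.trans h1) h3 h2' hne
        exact h2'.not_reachable (this.trans h3'.symm)
      obtain ⟨rfl, rfl⟩ := Prod.ext_iff.1 huv
      rw [ih h4']

open Classical in
-- A path never returns to its start, so what follows a bridge avoids that bridge; a dart that is no
-- bridge stays in its block.
theorem isBridgeList_of_isPath {p : G.Walk i j} (hp : p.IsPath) :
    IsBridgeList G i j
      ((p.darts.map fun d => d.toProd).filter fun e => BridgeEdge G e.1 e.2) := by
  induction p with
  | nil => exact .nil rfl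
  | @cons i v j h p ih =>
    rw [SimpleGraph.Walk.cons_isPath_iff] at hp
    simp only [SimpleGraph.Walk.darts_cons, List.map_cons, List.filter_cons]
    split_ifs with hb
    · have hb' : BridgeEdge G i v := by simpa using hb
      refine .cons rfl hb' ?_ (ih hp.1)
      rw [SimpleGraph.reachable_deleteEdges_iff_exists_walk]
      exact ⟨p, fun hmem => hp.2 (p.fst_mem_support_of_mem_edges hmem)⟩
    · exact (ih hp.1).congr_left (blockOf_eq_of_adj h (by simpa using hb))

theorem isBridgeList_bridgePath (h : G.Reachable i j) :
    IsBridgeList G i j (bridgePath G i j) := by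
  have hp : ∃ p : G.Walk i j, p.IsPath := h.exists_isPath
  rw [bridgePath, dif_pos hp]
  exact isBridgeList_of_isPath hp.choose_spec

theorem IsBridgeList.bridgePath_eq (h : IsBridgeList G i j l) (hij : G.Reachable i j) :
    bridgePath G i j = l :=
  (isBridgeList_bridgePath hij).unique h

theorem bridgePath_of_not_reachable (h : ¬ G.Reachable i j) : bridgePath G i j = [] :=
  dif_neg fun ⟨p, _⟩ => h p.reachable

end Bridges

/-! ### The identity `Θ * R = 1` -/

section Inverse

variable {V : Type*} {G : SimpleGraph V}

/-- The product of local entries along a list of bridges, normalized by the diagonal of `S`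
at the ends of the bridges. -/
noncomputable def bridgeProduct [Fintype V] [DecidableEq V]
    (G : SimpleGraph V) (S T : Matrix V V ℝ) (Θhat : ClusterMatrices G) : V → V → List (V × V) → ℝ
  | i, j, [] => localEntry G T Θhat i j
  | i, j, (u, v) :: l =>
    localEntry G T Θhat i u / S u u * (T u v / S v v * bridgeProduct G S T Θhat v j l)

open Classical in
/-- The block diagonal matrix assembled from matrices on the clusters. -/
noncomputable def blockMatrix (M : ClusterMatrices G) : Matrix V V ℝ :=
  fun i j => if h : blockOf G i = blockOf G j then M (blockOf G j) ⟨i, h⟩ ⟨j, rfl⟩ else 0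

theorem blockMatrix_apply_val (M : ClusterMatrices G) {k : Block G} (a b : Cluster G k) :
    blockMatrix M a b = M k a b := by
  obtain ⟨a, ha⟩ := a
  obtain ⟨b, rfl⟩ := b
  exact dif_pos ha

theorem blockMatrix_of_ne (M : ClusterMatrices G) {i j : V} (h : blockOf G i ≠ blockOf G j) :
    blockMatrix M i j = 0 :=
  dif_neg h

variable [Fintype V]

open Classical in
theorem sum_ite_blockOf_eq (f : V → ℝ) (k : Block G) :
    (∑ m, if blockOf G m = k then f m else 0) = ∑ m : Cluster G k, f m := by
  rw [← Finset.sum_filter]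
  exact (Finset.sum_subtype _ (by simp) f)

variable [DecidableEq V]

open Classical in
theorem blockMatrix_mul_blockMatrix {M N : ClusterMatrices G} (h : ∀ k, M k * N k = 1) :
    blockMatrix M * blockMatrix N = 1 := by
  ext i j
  by_cases hij : blockOf G i = blockOf G j
  · have h1 : ∀ m, blockMatrix M i m * blockMatrix N m j =
        if blockOf G m = blockOf G j then blockMatrix M i m * blockMatrix N m j else 0 := by
      intro m
      split_ifs with hm
      · rfl
      · rw [blockMatrix_of_ne N hm, mul_zero]
    rw [Matrix.mul_apply, Finset.sum_congr rfl fun m _ => h1 m, sum_ite_blockOf_eq]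
    have h2 := congrFun (congrFun (h (blockOf G j)) ⟨i, hij⟩) ⟨j, rfl⟩
    rw [Matrix.mul_apply] at h2
    have h3 : ∀ m : Cluster G (blockOf G j), blockMatrix M i m * blockMatrix N m j =
        M (blockOf G j) ⟨i, hij⟩ m * N (blockOf G j) m ⟨j, rfl⟩ := fun m => by
      rw [← blockMatrix_apply_val M, ← blockMatrix_apply_val N]
    rw [Finset.sum_congr rfl fun m _ => h3 m, h2, Matrix.one_apply, Matrix.one_apply]
    simp
  · rw [Matrix.mul_apply, Matrix.one_apply_ne fun h => hij (congrArg _ h)]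
    refine Finset.sum_eq_zero fun m _ => ?_
    by_cases him : blockOf G i = blockOf G m
    · rw [blockMatrix_of_ne N (fun h => hij (him.trans h)), mul_zero]
    · rw [blockMatrix_of_ne M him, zero_mul]

variable {S T : Matrix V V ℝ} {Θhat : ClusterMatrices G} {i j u v m : V}
  {l : List (V × V)}

theorem localEntry_of_eq (h : blockOf G i = blockOf G j) :
    localEntry G T Θhat i j = blockMatrix (clusterInverse G Θhat) i j := by
  rw [localEntry, blockMatrix, dif_pos h, dif_pos h]

theorem localEntry_of_ne (h : blockOf G i ≠ blockOf G j) :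
    localEntry G T Θhat i j = T i j :=
  dif_neg h

/-- Each bridge end occurs in two consecutive factors, whose square roots combine to a diagonal
entry of `S`; only `i` and `j` keep a root. -/
theorem prod_zipWith_bridgeVertices (hS : ∀ i, 0 < S i i) (h : IsBridgeList G i j l) :
    (List.zipWith (fun a b => localEntry G T Θhat a b / √(S a a * S b b))
      (bridgeVertices i j l) (bridgeVertices i j l).tail).prod =
      bridgeProduct G S T Θhat i j l / √(S i i * S j j) := by
  induction h with
  | nil => simp [bridgeVertices, bridgeProduct]
  | @cons i j u v l h1 h2 h3 h4 ih =>
    have hcons : bridgeVertices i j ((u, v) :: l) = i :: u :: bridgeVertices v j l := by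
      simp [bridgeVertices]
    have hv : bridgeVertices v j l = v :: (bridgeVertices v j l).tail := by
      simp [bridgeVertices]
    rw [hcons, List.tail_cons]
    nth_rewrite 2 [hv]
    rw [List.zipWith_cons_cons]
    nth_rewrite 1 [hv]
    rw [List.zipWith_cons_cons, ← hv, List.prod_cons, List.prod_cons, ih,
      localEntry_of_ne h2.blockOf_ne, bridgeProduct]
    rw [Real.sqrt_mul (hS _).le, Real.sqrt_mul (hS _).le, Real.sqrt_mul (hS _).le,
      Real.sqrt_mul (hS _).le]
    have hu := Real.sq_sqrt (hS u).le
    have hv' := Real.sq_sqrt (hS v).le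
    have := Real.sqrt_pos.2 (hS u)
    have := Real.sqrt_pos.2 (hS v)
    have := Real.sqrt_pos.2 (hS i)
    have := Real.sqrt_pos.2 (hS j)
    rw [← hu, ← hv']
    simp only [Real.sqrt_sq (Real.sqrt_nonneg _)]
    field_simp

/-- One recursive formula covers all three cases of `R` for connected vertices: diagonal local
entries equal those of `S`, so they cancel around a lone bridge. -/
theorem inverseForm_eq_bridgeProduct (hS : ∀ i, 0 < S i i)
    (hL : ∀ i, localEntry G T Θhat i i = S i i) (hij : G.Reachable i j)
    (h : IsBridgeList G i j l) :
    inverseForm G S T Θhat i j = bridgeProduct G S T Θhat i j l := by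
  have hpath := h.bridgePath_eq hij
  rw [inverseForm]
  split_ifs with h1 h2
  · rw [h.unique (.nil h1), bridgeProduct, localEntry, dif_pos h1]
  · rw [h.unique (.cons rfl h2 (.refl _) (.nil rfl)), bridgeProduct, bridgeProduct, hL, hL]
    have := (hS i).ne'
    have := (hS j).ne'
    field_simp
  -- The default value `0` of `pathProduct` on an empty list does not interfere: here the blocks
  -- differ.
  · have hl : l ≠ [] := by
      rintro rfl
      cases h with
      | nil h => exact h1 h
    rw [pathProduct, hpath, if_neg hl, prod_zipWith_bridgeVertices hS h]
    have := Real.sqrt_pos.2 (mul_pos (hS i) (hS j))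
    field_simp

theorem inverseForm_of_not_reachable (h : ¬ G.Reachable i j) :
    inverseForm G S T Θhat i j = 0 := by
  rw [inverseForm, dif_neg fun hb => h (reachable_of_blockOf_eq hb),
    if_neg fun hb => h hb.1.reachable, pathProduct, if_pos (bridgePath_of_not_reachable h),
    mul_zero]

theorem inverseForm_of_blockOf_eq (h : blockOf G i = blockOf G j) :
    inverseForm G S T Θhat i j = blockMatrix (clusterInverse G Θhat) i j := by
  rw [inverseForm, blockMatrix, dif_pos h, dif_pos h]

theorem inverseForm_of_bridgeEdge (h : BridgeEdge G i j) :
    inverseForm G S T Θhat i j = T i j := by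
  rw [inverseForm, dif_neg h.blockOf_ne, if_pos h]

/-- Crossing a bridge away from `j`. -/
theorem inverseForm_of_bridgeEdge_away (hS : ∀ i, 0 < S i i)
    (hL : ∀ i, localEntry G T Θhat i i = S i i) (him : BridgeEdge G i m)
    (hij : (G.deleteEdges {s(i, m)}).Reachable i j) :
    inverseForm G S T Θhat m j = T m i / S i i * inverseForm G S T Θhat i j := by
  have hr : G.Reachable i j := hij.mono (SimpleGraph.deleteEdges_le _)
  have hl := isBridgeList_bridgePath hr
  rw [inverseForm_eq_bridgeProduct hS hL hr hl,
    inverseForm_eq_bridgeProduct hS hL (him.1.symm.reachable.trans hr)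
      (.cons rfl him.symm (by rwa [Sym2.eq_swap]) hl), bridgeProduct, hL, div_self (hS m).ne',
    one_mul]

/-- Moving inside a cluster towards the bridge `(u, v)` that leads to `j`. -/
theorem inverseForm_of_bridgeEdge_towards (hS : ∀ i, 0 < S i i)
    (hL : ∀ i, localEntry G T Θhat i i = S i i) (hiu : blockOf G i = blockOf G u)
    (huv : BridgeEdge G u v) (hvj : (G.deleteEdges {s(u, v)}).Reachable v j) :
    inverseForm G S T Θhat i j = blockMatrix (clusterInverse G Θhat) i u *
      (T u v / (S u u * S v v) * inverseForm G S T Θhat v j) := by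
  have hr : G.Reachable v j := hvj.mono (SimpleGraph.deleteEdges_le _)
  have hl := isBridgeList_bridgePath hr
  rw [inverseForm_eq_bridgeProduct hS hL hr hl,
    inverseForm_eq_bridgeProduct hS hL
      ((reachable_of_blockOf_eq hiu).trans (huv.1.reachable.trans hr))
      (.cons hiu huv hvj hl), bridgeProduct, localEntry_of_eq hiu]
  field_simp

theorem decomposedForm_apply (i j : V) :
    decomposedForm G S T Θhat i j = blockMatrix Θhat i j + (if i = j then zeta G S T i else 0) +
      (open Classical in if BridgeEdge G i j then -T i j / (S i i * S j j - T i j ^ 2) else 0) := by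
  rw [decomposedForm, blockMatrix]
  by_cases h1 : blockOf G i = blockOf G j
  · rw [dif_pos h1, dif_pos h1, if_neg fun h : BridgeEdge G i j => h.blockOf_ne h1, add_zero]
  · rw [dif_neg h1, dif_neg h1, if_neg fun h : i = j => h1 (congrArg _ h), zero_add, zero_add]

open Classical in
-- The summands of `zeta` are paired with the off-diagonal bridge entries, giving one term per
-- bridge at `i`.
theorem decomposedForm_mul_apply (R : Matrix V V ℝ) (i j : V) :
    (decomposedForm G S T Θhat * R) i j = (blockMatrix Θhat * R) i j +
      ∑ m, if BridgeEdge G i m then (T i m ^ 2 * (R i j / S i i) - T i m * R m j) /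
        (S i i * S m m - T i m ^ 2) else 0 := by
  have h : ∀ m, decomposedForm G S T Θhat i m * R m j = blockMatrix Θhat i m * R m j +
      ((if i = m then zeta G S T i * R m j else 0) +
        if BridgeEdge G i m then -T i m / (S i i * S m m - T i m ^ 2) * R m j else 0) := by
    intro m
    rw [decomposedForm_apply, add_mul, add_mul, ite_mul, ite_mul, zero_mul, add_assoc]
  rw [Matrix.mul_apply, Matrix.mul_apply, Finset.sum_congr rfl fun m _ => h m,
    Finset.sum_add_distrib, Finset.sum_add_distrib, Finset.sum_ite_eq, if_pos (Finset.mem_univ _),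
    zeta, mul_assoc, Finset.sum_mul, Finset.mul_sum, ← Finset.sum_add_distrib]
  congr 1
  refine Finset.sum_congr rfl fun m _ => ?_
  split_ifs
  · ring
  · ring

/-- A column that is a multiple of a column of the block diagonal inverse on a cluster. -/
theorem blockMatrix_mul_apply_of_column {R : Matrix V V ℝ} {c : ℝ}
    (hinv : blockMatrix Θhat * blockMatrix (clusterInverse G Θhat) = 1)
    (h : ∀ m, blockOf G i = blockOf G m →
      R m j = blockMatrix (clusterInverse G Θhat) m u * c) :
    (blockMatrix Θhat * R) i j = if i = u then c else 0 := by
  have h1 : (blockMatrix Θhat * R) i j =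
      (blockMatrix Θhat * blockMatrix (clusterInverse G Θhat)) i u * c := by
    rw [Matrix.mul_apply, Matrix.mul_apply, Finset.sum_mul]
    refine Finset.sum_congr rfl fun m _ => ?_
    by_cases him : blockOf G i = blockOf G m
    · rw [h m him, mul_assoc]
    · rw [blockMatrix_of_ne _ him, zero_mul, zero_mul, zero_mul]
  rw [h1, hinv, Matrix.one_apply, ite_mul, one_mul, zero_mul]

theorem decomposedForm_mul_inverseForm (hS : ∀ i, 0 < S i i)
    (hL : ∀ i, localEntry G T Θhat i i = S i i) (hT : ∀ i j, T i j = T j i)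
    (hden : ∀ i j, BridgeEdge G i j → T i j ^ 2 ≠ S i i * S j j)
    (hinv : blockMatrix Θhat * blockMatrix (clusterInverse G Θhat) = 1) :
    decomposedForm G S T Θhat * inverseForm G S T Θhat = 1 := by
  classical
  ext i j
  rw [decomposedForm_mul_apply]
  have haway : ∀ m, BridgeEdge G i m → (G.deleteEdges {s(i, m)}).Reachable i j →
      T i m ^ 2 * (inverseForm G S T Θhat i j / S i i)
        - T i m * inverseForm G S T Θhat m j = 0 := by
    intro m hm hr
    rw [inverseForm_of_bridgeEdge_away hS hL hm hr, hT m i]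
    ring
  by_cases hij : G.Reachable i j
  swap
  · have hm : ∀ m, G.Reachable i m → inverseForm G S T Θhat m j = 0 := fun m hm =>
      inverseForm_of_not_reachable fun h => hij (hm.trans h)
    have hne : i ≠ j := by
      rintro rfl
      exact hij (.refl _)
    rw [Matrix.one_apply_ne hne, Matrix.mul_apply, Finset.sum_eq_zero, Finset.sum_eq_zero,
      add_zero]
    · intro m _
      split_ifs with hb
      · rw [hm i (.refl _), hm m hb.1.reachable]
        simp
      · rfl
    · intro m _
      by_cases hb : blockOf G i = blockOf G m
      · rw [hm m (reachable_of_blockOf_eq hb), mul_zero]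
      · rw [blockMatrix_of_ne _ hb, zero_mul]
  have hlist := isBridgeList_bridgePath hij
  generalize bridgePath G i j = l at hlist
  cases hlist with
  | nil hb =>
    rw [blockMatrix_mul_apply_of_column (u := j) (c := 1) hinv, Finset.sum_eq_zero, add_zero,
      Matrix.one_apply]
    · intro m _
      split_ifs with hm
      · rw [haway m hm (hm.reachable_deleteEdges hb), zero_div]
      · rfl
    · intro m hm
      rw [mul_one, inverseForm_of_blockOf_eq (hm.symm.trans hb)]
  | @cons _ _ u v l hiu huv hvj _ =>
    have hne : i ≠ j := fun h => not_blockOf_eq_of_reachable huv hiu hvj (h ▸ rfl)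
    rw [Matrix.one_apply_ne hne,
      blockMatrix_mul_apply_of_column (u := u)
        (c := T u v / (S u u * S v v) * inverseForm G S T Θhat v j) hinv
        fun m hm => inverseForm_of_bridgeEdge_towards hS hL (hm.symm.trans hiu) huv hvj]
    have hterm : ∀ m, (i, m) ≠ (u, v) →
        (if BridgeEdge G i m then (T i m ^ 2 * (inverseForm G S T Θhat i j / S i i)
          - T i m * inverseForm G S T Θhat m j) / (S i i * S m m - T i m ^ 2) else 0) = 0 := by
      intro m hm
      split_ifs with hb
      · rw [haway m hb (huv.reachable_of_ne hiu hvj hb hm), zero_div]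
      · rfl
    split_ifs with hi
    -- At the exit `u`, only the term of `(u, v)` survives; it equals `-T_uv / (S_uu S_vv) * R_vj`,
    -- the negative of the cluster contribution.
    · subst hi
      rw [Finset.sum_eq_single v (fun m _ hm => hterm m (by simpa using hm)) (by simp),
        if_pos huv, inverseForm_of_bridgeEdge_towards hS hL rfl huv hvj,
        ← localEntry_of_eq (T := T) rfl, hL]
      have := (hS i).ne'
      have := (hS v).ne'
      have : S i i * S v v - T i v ^ 2 ≠ 0 := sub_ne_zero.2 (hden i v huv).symm
      field_simp
      ring
    · rw [Finset.sum_eq_zero fun m _ => hterm m (by simp [hi]), add_zero]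

end Inverse

/-! ### Gaps at bridges and inside clusters; the main theorem -/

section Main

variable {V : Type*} {G : SimpleGraph V} {S Λ T : Matrix V V ℝ} {i j : V}

theorem thresholded_transpose_apply (hS : S.IsSymm) (hΛ : Λ.IsSymm) (i j : V) :
    thresholded S Λ i j = thresholded S Λ j i := by
  rw [thresholded, thresholded, hS.apply j i, hΛ.apply j i]

theorem thresholded_ne_zero_of_adj (hS : S.IsSymm) (hΛ : Λ.IsSymm)
    (h : (supportGraph (thresholded S Λ)).Adj i j) : thresholded S Λ i j ≠ 0 := by
  rw [supportGraph, SimpleGraph.fromRel_adj] at h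
  rcases h.2 with h | h
  · exact h
  · rwa [thresholded_transpose_apply hS hΛ]

/-- Here `S - T = Λ * sign T`, while `-T / d` has the sign opposite to `T`, so the expression
collapses to `Λ * (|x| + x)` or `Λ * (|x| - x)`. -/
theorem sub_thresholded_mul_add_abs_nonneg (hΛ : 0 ≤ Λ i j) (h : thresholded S Λ i j ≠ 0)
    {d : ℝ} (hd : 0 < d) (x : ℝ) :
    0 ≤ (x - -thresholded S Λ i j / d) * (S i j - thresholded S Λ i j)
      + Λ i j * (|x| - |-thresholded S Λ i j / d|) := by
  have hlt : ¬ |S i j| ≤ Λ i j := fun hle => h (if_pos hle)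
  have hval : thresholded S Λ i j = S i j - Λ i j * Real.sign (S i j) := if_neg hlt
  rw [not_le] at hlt
  have hx1 := neg_abs_le x
  have hx2 := le_abs_self x
  rw [abs_div, abs_neg, abs_of_pos hd]
  rcases lt_trichotomy (S i j) 0 with hs | hs | hs
  · rw [Real.sign_of_neg hs] at hval
    rw [abs_of_neg hs] at hlt
    have ht : thresholded S Λ i j < 0 := by linarith
    have h1 : S i j - thresholded S Λ i j = -Λ i j := by linarith
    rw [h1, abs_of_neg ht]
    have := mul_nonneg hΛ (sub_nonneg.2 hx2)
    linarith
  · rw [hs, abs_zero] at hlt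
    exact absurd hΛ (not_le.2 hlt)
  · rw [Real.sign_of_pos hs] at hval
    rw [abs_of_pos hs] at hlt
    have ht : 0 < thresholded S Λ i j := by linarith
    have h1 : S i j - thresholded S Λ i j = Λ i j := by linarith
    rw [h1, abs_of_pos ht, neg_div]
    have := mul_nonneg hΛ (neg_le_iff_add_nonneg.1 hx1)
    linarith

theorem clusterSubmatrix_nonneg (hΛ : ∀ i j, i ≠ j → 0 ≤ Λ i j) (k : Block G) :
    ∀ a b, a ≠ b → 0 ≤ clusterSubmatrix G Λ k a b :=
  fun _ _ hab => hΛ _ _ fun h => hab (Subtype.ext h)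

theorem blockMatrix_diag (M : ClusterMatrices G) (i : V) :
    blockMatrix M i i = M (blockOf G i) ⟨i, rfl⟩ ⟨i, rfl⟩ :=
  dif_pos rfl

variable [Fintype V] [DecidableEq V] {Θhat : ClusterMatrices G}

open Classical in
theorem clusterInverse_diag (hΛ : ∀ i j, i ≠ j → 0 ≤ Λ i j)
    (hΘhat : ∀ k, IsClusterOptimal G S Λ k (Θhat k)) (i : V) :
    blockMatrix (clusterInverse G Θhat) i i = S i i := by
  have hopt : IsOptimal (clusterSubmatrix G S (blockOf G i))
    (clusterSubmatrix G Λ (blockOf G i)) (Θhat (blockOf G i)) := hΘhat _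
  rw [blockMatrix_diag]
  exact hopt.inv_diag (clusterSubmatrix_nonneg hΛ _) _

open Classical in
-- Positivity comes from the existence of the sub-solutions: `S_ii` is a diagonal entry of a
-- positive definite inverse.
theorem clusterOptimal_diag_pos (hΛ : ∀ i j, i ≠ j → 0 ≤ Λ i j)
    (hΘhat : ∀ k, IsClusterOptimal G S Λ k (Θhat k)) (i : V) : 0 < S i i := by
  rw [← clusterInverse_diag hΛ hΘhat i, blockMatrix_diag]
  have : (clusterInverse G Θhat (blockOf G i)).PosDef := (hΘhat (blockOf G i)).1.inv
  exact this.diag_pos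

open Classical in
theorem blockMatrix_mul_clusterInverse (hΘhat : ∀ k, IsClusterOptimal G S Λ k (Θhat k)) :
    blockMatrix Θhat * blockMatrix (clusterInverse G Θhat) = 1 := by
  refine blockMatrix_mul_blockMatrix fun k => ?_
  have hpd : (Θhat k).PosDef := (hΘhat k).1
  exact Matrix.mul_nonsing_inv _ hpd.det_pos.ne'.isUnit

open Classical in
theorem sum_sum_ite_blockOf_eq (f : V → V → ℝ) :
    (∑ i, ∑ j, if blockOf G i = blockOf G j then f i j else 0) =
      ∑ k : Block G, ∑ i : Cluster G k, ∑ j : Cluster G k, f i j := by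
  rw [← Fintype.sum_fiberwise (fun i => blockOf G i)]
  refine Finset.sum_congr rfl fun k _ => Finset.sum_congr rfl fun i _ => ?_
  rw [← sum_ite_blockOf_eq]
  refine Finset.sum_congr rfl fun j _ => ?_
  rw [i.2]
  exact if_congr eq_comm rfl rfl

open Classical in
/-- The gaps inside the clusters sum to a nonnegative number. -/
theorem sum_entryGap_cluster_nonneg (hΛ : ∀ i j, i ≠ j → 0 ≤ Λ i j)
    (hΘhat : ∀ k, IsClusterOptimal G S Λ k (Θhat k)) {X : Matrix V V ℝ} (hX : X.IsHermitian) :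
    0 ≤ ∑ i, ∑ j, if blockOf G i = blockOf G j then
      entryGap S Λ (decomposedForm G S T Θhat) (inverseForm G S T Θhat) X i j else 0 := by
  rw [sum_sum_ite_blockOf_eq]
  refine Finset.sum_nonneg fun k _ => ?_
  have hopt : IsOptimal (clusterSubmatrix G S k) (clusterSubmatrix G Λ k) (Θhat k) := hΘhat k
  have h := hopt.sum_entryGap_nonneg (clusterSubmatrix_nonneg hΛ k)
    (hX.submatrix (Subtype.val : Cluster G k → V))
  refine h.trans_eq (Finset.sum_congr rfl fun a _ => Finset.sum_congr rfl fun b _ => ?_)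
  have hab : blockOf G (a : V) = blockOf G (b : V) := a.2.trans b.2.symm
  have hR : inverseForm G S T Θhat a b = (Θhat k)⁻¹ a b := by
    rw [inverseForm_of_blockOf_eq hab, blockMatrix_apply_val, clusterInverse]
  have hΘ : decomposedForm G S T Θhat a b =
      Θhat k a b + if a = b then zeta G S T a else 0 := by
    rw [decomposedForm_apply, if_neg fun h : BridgeEdge G a b => h.blockOf_ne hab, add_zero,
      blockMatrix_apply_val]
    simp only [Subtype.ext_iff]
  rw [entryGap, entryGap, hR, hΘ]
  -- The shift by `zeta` affects only diagonal gaps, where its factor `S_aa - R_aa` vanishes.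
  by_cases h1 : a = b
  · subst h1
    have : (Θhat k)⁻¹ a a = S a a := by
      rw [← hR, inverseForm_of_blockOf_eq rfl, clusterInverse_diag hΛ hΘhat]
    simp [this, clusterSubmatrix]
  · simp [h1, clusterSubmatrix, Subtype.ext_iff.not.1 h1]

end Main

end GLasso

theorem theorem3 {V : Type*} [Fintype V] [DecidableEq V]
    (S Λ T : Matrix V V ℝ) (G : SimpleGraph V)
    (hS : S.IsSymm) (hΛ : Λ.IsSymm) (hΛ_nonneg : ∀ i j, i ≠ j → 0 ≤ Λ i j)
    (hT : T = GLasso.thresholded S Λ) (hG : G = GLasso.supportGraph T)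
    (hden : ∀ i j, GLasso.BridgeEdge G i j → T i j ^ 2 ≠ S i i * S j j)
    (Θhat : GLasso.ClusterMatrices G)
    (hΘhat : ∀ k, GLasso.IsClusterOptimal G S Λ k (Θhat k))
    (Θ R : Matrix V V ℝ)
    (hΘ : Θ = GLasso.decomposedForm G S T Θhat)
    (hR : R = GLasso.inverseForm G S T Θhat) :
    Θ * R = 1 ∧
      (Θ.PosDef →
        (∀ i j, GLasso.blockOf G i ≠ GLasso.blockOf G j → |S i j - R i j| ≤ Λ i j) →
        GLasso.IsOptimal S Λ Θ) := by
  classical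
  have hdiag := GLasso.clusterInverse_diag hΛ_nonneg hΘhat
  have hSpos := GLasso.clusterOptimal_diag_pos hΛ_nonneg hΘhat
  have hTsymm : ∀ i j, T i j = T j i := fun i j => by
    rw [hT, GLasso.thresholded_transpose_apply hS hΛ]
  have hmul : Θ * R = 1 := by
    rw [hΘ, hR]
    exact GLasso.decomposedForm_mul_inverseForm hSpos
      (fun i => (GLasso.localEntry_of_eq rfl).trans (hdiag i)) hTsymm hden
      (GLasso.blockMatrix_mul_clusterInverse hΘhat)
  refine ⟨hmul, fun hpd hcross => GLasso.isOptimal_of_sum_entryGap_nonneg hpd fun X hX => ?_⟩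
  have hinv : Θ⁻¹ = R := Matrix.inv_eq_right_inv hmul
  have hRpd : R.PosDef := hinv ▸ hpd.inv
  rw [hinv]
  have hsplit : ∀ i j, GLasso.entryGap S Λ Θ R X i j =
      (if GLasso.blockOf G i = GLasso.blockOf G j then GLasso.entryGap S Λ Θ R X i j else 0) +
        if GLasso.blockOf G i = GLasso.blockOf G j then 0 else GLasso.entryGap S Λ Θ R X i j :=
    fun i j => by split_ifs <;> simp
  rw [Finset.sum_congr rfl fun i _ => Finset.sum_congr rfl fun j _ => hsplit i j]
  simp only [Finset.sum_add_distrib]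
  refine add_nonneg ?_ (Finset.sum_nonneg fun i _ => Finset.sum_nonneg fun j _ => ?_)
  · rw [hΘ, hR]
    exact GLasso.sum_entryGap_cluster_nonneg hΛ_nonneg hΘhat hX.1
  split_ifs with hb
  · rfl
  have hij : i ≠ j := fun h => hb (congrArg _ h)
  have hΘij : Θ i j =
      if GLasso.BridgeEdge G i j then -T i j / (S i i * S j j - T i j ^ 2) else 0 := by
    rw [hΘ, GLasso.decomposedForm_apply, GLasso.blockMatrix_of_ne _ hb, if_neg hij, zero_add,
      zero_add]
  rw [GLasso.entryGap, if_pos hij, hΘij]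
  split_ifs with hbr
  · have hRd : ∀ i, R i i = S i i := fun i => by
      rw [hR, GLasso.inverseForm_of_blockOf_eq rfl, hdiag]
    have hRij : R i j = T i j := by rw [hR, GLasso.inverseForm_of_bridgeEdge hbr]
    have hRji : R j i = T i j := by
      rw [hR, GLasso.inverseForm_of_bridgeEdge hbr.symm, hTsymm]
    -- This is a principal minor of the positive definite `R`; its sign, not just its being nonzero,
    -- makes `Θ_ij` opposite in sign to `T_ij`.
    have hminor : 0 < S i i * S j j - T i j ^ 2 := by
      have h2 := (hRpd.submatrix (e := ![i, j]) (by
        intro a b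
        fin_cases a <;> fin_cases b <;> simp [hij, hij.symm])).det_pos
      rw [Matrix.det_fin_two] at h2
      simp only [Matrix.submatrix_apply, Matrix.cons_val_zero, Matrix.cons_val_one, hRd, hRij,
        hRji] at h2
      rwa [pow_two]
    rw [hRij, hT]
    rw [hT] at hminor
    refine GLasso.sub_thresholded_mul_add_abs_nonneg (hΛ_nonneg i j hij) ?_ hminor _
    refine GLasso.thresholded_ne_zero_of_adj hS hΛ ?_
    rw [← hT, ← hG]
    exact hbr.1
  · rw [sub_zero, abs_zero, sub_zero, mul_comm (Λ i j)]
    -- With `Θ_ij = 0` the gap is `X_ij (S_ij - R_ij) + Λ_ij |X_ij|`.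
    have h1 := mul_le_mul_of_nonneg_left (hcross i j hb) (abs_nonneg (X i j))
    rw [← abs_mul] at h1
    have h2 := neg_abs_le (X i j * (S i j - R i j))
    linarith
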